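/- Let $\vec f:\mathbb{R}\times\mathbb{R}^n\to\mathbb{R}^n$ be such that for every $\vec x_0\in\mathbb{R}^n$ the initial value problem $\frac{\mathrm d}{\mathrm dt}\vec x=\vec f(t,\vec x)$, $\vec x(0)=\vec x_0$, has a solution $\vec x(t;\vec x_0)$ for all $t\ge 0$, which is unique on every interval $[0,\tau]$, $\tau>0$. Let $T>0$, let $\mathcal X_0,\mathcal X\subseteq\mathbb{R}^n$ be such that $\vec x(t;\vec x_0)\in\mathcal X$ for all $\vec x_0\in\mathcal X_0$ and $t\in[0,T]$, and let $\vec h:\mathbb{R}^n\to\mathbb{R}^m$, $\vec c\in\mathbb{R}^m$ and $g:\mathbb{R}^n\to\mathbb{R}$. Assume that $\vec f$ is continuous on $[0,T]\times\mathcal X$, $\vec h$ is continuous on $\mathcal X_0$, and $g$ is continuous on $\mathcal X$. Let $$p^\star=\sup\Big\{\int_{\mathcal X_0} g(\vec x(T;\vec x_0))\,\mathrm d\mu_0(\vec x_0)\;:\;\mu_0 \text{ a probability measure supported on } \mathcal X_0,\ \int_{\mathcal X_0}\vec h\,\mathrm d\mu_0\le\vec c \text{ componentwise}\Big\},$$ and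 let $d^\star$ be the infimum of $\alpha+\boldsymbol\beta\cdot\vec c$ over all $\alpha\in\mathbb{R}$, all $\boldsymbol\beta\in\mathbb{R}^m$ with nonnegative entries, and all functions $v\in C^1([0,T]\times\mathcal X)$ (that is, $v$ is continuously differentiable on an open neighbourhood of $[0,T]\times\mathcal X$ in $\mathbb{R}\times\mathbb{R}^n$) such that $$\begin{aligned} \partial_t v(t,\vec x)+\vec f(t,\vec x)\cdot\nabla_{\vec x}v(t,\vec x)&\le 0 &&\text{for all }(t,\vec x)\in[0,T]\times\mathcal X,\\ g(\vec x)&\le v(T,\vec x)&&\text{for all }\vec x\in\mathcal X,\\ v(0,\vec x)&\le\alpha+\boldsymbol\beta\cdot\vec h(\vec x)&&\text{for all }\vec x\in\mathcal X_0. \end{aligned}$$ Both are taken in $[-\infty,\infty]$, with $\sup\emptyset=-\infty$ and $\inf\emptyset=+\infty$. Theorem. If $\mathcal X_0$ and $\mathcal X$ are compact, then $p^\star=d^\star$. -/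

import Mathlib

open Set MeasureTheory

/-- `x` solves `x' = f(t, x)`, `x(0) = x₀` on the time set `I` (an interval starting at `0`;
derivatives at its end points are one-sided). -/
def IsSolutionOn {n : ℕ} (f : ℝ → EuclideanSpace ℝ (Fin n) → EuclideanSpace ℝ (Fin n))
    (x₀ : EuclideanSpace ℝ (Fin n)) (I : Set ℝ) (x : ℝ → EuclideanSpace ℝ (Fin n)) : Prop :=
  x 0 = x₀ ∧ ∀ t ∈ I, HasDerivWithinAt x (f t (x t)) I t

/-- Solutions of `x' = f(t, x)`, `x(0) = x₀` exist for all positive times and are unique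
(on every interval `[0, τ]`). -/
def WellPosed {n : ℕ} (f : ℝ → EuclideanSpace ℝ (Fin n) → EuclideanSpace ℝ (Fin n)) : Prop :=
  ∀ x₀ : EuclideanSpace ℝ (Fin n), ∃ x : ℝ → EuclideanSpace ℝ (Fin n),
    IsSolutionOn f x₀ (Ici 0) x ∧
      ∀ τ : ℝ, 0 < τ → ∀ y : ℝ → EuclideanSpace ℝ (Fin n),
        IsSolutionOn f x₀ (Icc 0 τ) y → EqOn y x (Icc 0 τ)

/-- The state `x(t; x₀)`, for `t ≥ 0`, of the solution that starts at `x₀` at time `0`. -/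
noncomputable def flow {n : ℕ}
    {f : ℝ → EuclideanSpace ℝ (Fin n) → EuclideanSpace ℝ (Fin n)}
    (hf : WellPosed f) (t : ℝ) (x₀ : EuclideanSpace ℝ (Fin n)) : EuclideanSpace ℝ (Fin n) :=
  (hf x₀).choose t

/-- `v ∈ C¹(D)`: `v` is continuously differentiable on an open neighbourhood of `D`. -/
def IsC1On {n : ℕ} (v : ℝ × EuclideanSpace ℝ (Fin n) → ℝ)
    (D : Set (ℝ × EuclideanSpace ℝ (Fin n))) : Prop :=
  ∃ U : Set (ℝ × EuclideanSpace ℝ (Fin n)), IsOpen U ∧ D ⊆ U ∧ ContDiffOn ℝ 1 v U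

/-- `𝓛v(t, x) = ∂ₜ v(t, x) + f(t, x) · ∇ₓ v(t, x)`. -/
noncomputable def lieDerivative {n : ℕ}
    (f : ℝ → EuclideanSpace ℝ (Fin n) → EuclideanSpace ℝ (Fin n))
    (v : ℝ × EuclideanSpace ℝ (Fin n) → ℝ) (t : ℝ) (x : EuclideanSpace ℝ (Fin n)) : ℝ :=
  deriv (fun s => v (s, x)) t + inner ℝ (f t x) (gradient (fun y => v (t, y)) x)

/-- `μ₀` is a probability measure supported on `X₀` with `∫ h dμ₀ ≤ c` componentwise. -/
def IsAdmissible {n m : ℕ} (X₀ : Set (EuclideanSpace ℝ (Fin n)))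
    (h : EuclideanSpace ℝ (Fin n) → Fin m → ℝ) (c : Fin m → ℝ)
    (μ₀ : Measure (EuclideanSpace ℝ (Fin n))) : Prop :=
  IsProbabilityMeasure μ₀ ∧ μ₀ X₀ᶜ = 0 ∧
    ∀ i, IntegrableOn (fun x => h x i) X₀ μ₀ ∧ ∫ x in X₀, h x i ∂μ₀ ≤ c i

/-- The maximal expectation `p⋆` (equal to `-∞` if no distribution is admissible). -/
noncomputable def pStar {n m : ℕ}
    {f : ℝ → EuclideanSpace ℝ (Fin n) → EuclideanSpace ℝ (Fin n)} (hf : WellPosed f) (T : ℝ)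
    (X₀ : Set (EuclideanSpace ℝ (Fin n))) (h : EuclideanSpace ℝ (Fin n) → Fin m → ℝ)
    (c : Fin m → ℝ) (g : EuclideanSpace ℝ (Fin n) → ℝ) : EReal :=
  sSup {r : EReal | ∃ μ₀ : Measure (EuclideanSpace ℝ (Fin n)), IsAdmissible X₀ h c μ₀ ∧
    r = ((∫ x₀ in X₀, g (flow hf T x₀) ∂μ₀ : ℝ) : EReal)}

/-- The constraints on the scalar `α`, the vector `β` and the auxiliary function `v`. -/
structure IsDualFeasible {n m : ℕ}
    (f : ℝ → EuclideanSpace ℝ (Fin n) → EuclideanSpace ℝ (Fin n)) (T : ℝ)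
    (X₀ X : Set (EuclideanSpace ℝ (Fin n))) (h : EuclideanSpace ℝ (Fin n) → Fin m → ℝ)
    (g : EuclideanSpace ℝ (Fin n) → ℝ)
    (α : ℝ) (β : Fin m → ℝ) (v : ℝ × EuclideanSpace ℝ (Fin n) → ℝ) : Prop where
  beta_nonneg : ∀ i, 0 ≤ β i
  isC1On : IsC1On v (Icc 0 T ×ˢ X)
  lie_nonpos : ∀ t ∈ Icc 0 T, ∀ x ∈ X, lieDerivative f v t x ≤ 0
  le_final : ∀ x ∈ X, g x ≤ v (T, x)
  initial_le : ∀ x ∈ X₀, v (0, x) ≤ α + ∑ i, β i * h x i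

/-- The optimal bound `d⋆`: the infimum of `α + β · c` over all feasible `(α, β, v)`. -/
noncomputable def dStar {n m : ℕ}
    (f : ℝ → EuclideanSpace ℝ (Fin n) → EuclideanSpace ℝ (Fin n)) (T : ℝ)
    (X₀ X : Set (EuclideanSpace ℝ (Fin n))) (h : EuclideanSpace ℝ (Fin n) → Fin m → ℝ)
    (c : Fin m → ℝ) (g : EuclideanSpace ℝ (Fin n) → ℝ) : EReal :=
  sInf {r : EReal | ∃ (α : ℝ) (β : Fin m → ℝ) (v : ℝ × EuclideanSpace ℝ (Fin n) → ℝ),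
    IsDualFeasible f T X₀ X h g α β v ∧ r = ((α + ∑ i, β i * c i : ℝ) : EReal)}

/-!
Weak duality holds because a feasible `v` decreases along trajectories. For the converse, write
`F x₀ = g (flow hf T x₀)`. It suffices to know that `F` is continuous on `X₀`, and that for every
`η > 0` some `C¹` supersolution `v` (that is, `𝓛v ≤ 0` on `[0, T] × X` and `g ≤ v(T, ·)` on `X`)
satisfies `v(0, ·) ≤ F + η` on `X₀`. The statement then reduces to Lagrange duality for the moment
problem `sup {∫ F dμ₀ | ∫ h dμ₀ ≤ c}`, in which finitely supported measures suffice
(`exists_multipliers`).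

The supersolution replaces any appeal to the superposition principle for the Liouville equation.
Fix `δ > 0` and consider chains of Euler steps `(t, x) ↦ (t + τ, x + τ f(d))` with `0 < τ < δ`,
whose velocity may be taken from any point `d ∈ [0, T] × X` within `δ` of `(t, x)`. Let
`V_δ(t, x)` be the supremum of `g(q)` over all `q ∈ X` such that a chain from `(t, x)` ends within
`δ` of `(T, q)` (`eulerValue`). All conditions are open, so `V_δ` is lower semicontinuous.

* By construction `V_δ` decreases along the direction `(1, f(d))` on the whole `δ`-ball around each
  `d ∈ [0, T] × X`, and `V_δ ≥ g(q)` on the `δ`-ball around `(T, q)`. Its mollification at radius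
  `δ` is therefore a smooth supersolution, with no error terms (`exists_supersolution`).
* As `δ → 0`, chains starting near `(0, x₀)` converge to solutions in `X`
  (`exists_solution_of_eulerReach`), hence by uniqueness to the trajectory of `x₀`. So `V_δ` is at
  most `F(x₀) + η` near `(0, x₀)` for small `δ` (`exists_eulerValue_le`).

Combining the two with the monotonicity of supersolutions along trajectories, for `g` and for `-g`,
gives the continuity of `F`; compactness of `X₀` then makes the choice of `δ` uniform.
-/

open Filter Topology

/-! ### Euler chains and their limits -/

section EulerChains

variable {E : Type*} [NormedAddCommGroup E] [NormedSpace ℝ E]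

/-- `EulerReach F D δ e z`: from the space-time point `z` one can get within distance `δ` of `e` by
finitely many Euler steps `z ↦ z + τ • (1, F d)` of length `0 < τ < δ`. The velocity `F d` of a step
may be taken from any point `d ∈ D` at distance less than `δ` from the point where the step starts;
because all the inequalities are strict, the set of such `z` is open. -/
inductive EulerReach (F : ℝ × E → E) (D : Set (ℝ × E)) (δ : ℝ) (e : ℝ × E) : ℝ × E → Prop
  | base (z : ℝ × E) : dist z e < δ → EulerReach F D δ e z
  | step (z d : ℝ × E) (τ : ℝ) : d ∈ D → dist z d < δ → 0 < τ → τ < δ →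
      EulerReach F D δ e (z + τ • ((1 : ℝ), F d)) → EulerReach F D δ e z

variable {F : ℝ × E → E} {D : Set (ℝ × E)} {δ M : ℝ} {e z : ℝ × E}

theorem isOpen_setOf_eulerReach : IsOpen {z | EulerReach F D δ e z} := by
  refine isOpen_iff_mem_nhds.2 fun z hz => ?_
  change EulerReach F D δ e z at hz
  induction hz with
  | base z hz =>
    filter_upwards [(isOpen_lt (continuous_id.dist continuous_const) continuous_const).mem_nhds hz]
      with z' hz' using .base z' hz'
  | step z d τ hd hz hτ hτδ _ ih =>
    have hc : Tendsto (fun z' : ℝ × E => z' + τ • ((1 : ℝ), F d)) (𝓝 z)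
        (𝓝 (z + τ • ((1 : ℝ), F d))) := (continuous_id.add continuous_const).tendsto z
    filter_upwards [(isOpen_lt (continuous_id.dist continuous_const) continuous_const).mem_nhds hz,
      hc ih] with z' hz' hr using .step z' d τ hd hz' hτ hτδ hr

theorem EulerReach.mono {δ' : ℝ} (hδ : δ ≤ δ') (h : EulerReach F D δ e z) :
    EulerReach F D δ' e z := by
  induction h with
  | base z hz => exact .base z (hz.trans_le hδ)
  | step z d τ hd hz hτ hτδ _ ih => exact .step z d τ hd (hz.trans_le hδ) hτ (hτδ.trans_le hδ) ih

/-- The polygon through the nodes of an Euler chain: its right derivative at each time is a value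
of `F` at a point of `D` near the current point of the graph. -/
theorem EulerReach.exists_curve (hM : ∀ d ∈ D, ‖F d‖ ≤ M) (h : EulerReach F D δ e z) :
    ∃ (t₁ : ℝ) (y : ℝ → E), z.1 ≤ t₁ ∧ y z.1 = z.2 ∧ ContinuousOn y (Icc z.1 t₁) ∧
      dist (t₁, y t₁) e < δ ∧ ∀ a ∈ Ico z.1 t₁, ∃ d ∈ D, dist (a, y a) d ≤ (2 + M) * δ ∧
        HasDerivWithinAt y (F d) (Ici a) a := by
  induction h with
  | base z hz =>
    refine ⟨z.1, fun _ => z.2, le_rfl, rfl, continuousOn_const, hz, fun a ha => ?_⟩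
    exact absurd (ha.1.trans_lt ha.2) (lt_irrefl _)
  | step z d τ hd hz hτ hτδ _ ih =>
    obtain ⟨t₁, y, h1, h2, h3, h4, h5⟩ := ih
    simp only [Prod.fst_add, Prod.smul_fst, smul_eq_mul, mul_one, Prod.snd_add, Prod.smul_snd]
      at h1 h2 h3 h5
    set t' := z.1 + τ with ht'
    set A : ℝ → E := fun a => z.2 + (a - z.1) • F d with hA
    set y' : ℝ → E := fun a => if a < t' then A a else y a with hy'
    have hlt : ∀ a, a < t' → y' a = A a := fun a ha => if_pos ha
    have hge : ∀ a, t' ≤ a → y' a = y a := fun a ha => if_neg ha.not_gt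
    have hle : ∀ a, a ≤ t' → y' a = A a := by
      intro a ha
      rcases ha.lt_or_eq with ha | rfl
      · exact hlt a ha
      · rw [hge _ le_rfl, h2]; simp [hA, ht']
    have hzt : z.1 < t' := by linarith
    refine ⟨t₁, y', by linarith, ?_, ?_, ?_, ?_⟩
    · rw [hlt _ hzt]; simp [hA]
    · rw [← Icc_union_Icc_eq_Icc hzt.le h1]
      refine ContinuousOn.union_of_isClosed ?_ ?_ isClosed_Icc isClosed_Icc
      · exact ContinuousOn.congr (by fun_prop) fun a ha => hle a ha.2
      · exact h3.congr fun a ha => hge a ha.1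
    · rwa [hge _ h1]
    · intro a ha
      rcases lt_or_ge a t' with hat | hat
      · refine ⟨d, hd, ?_, ?_⟩
        · have hn : ‖((1 : ℝ), F d)‖ ≤ 1 + M := by
            have := hM d hd
            have h0 := norm_nonneg (F d)
            exact norm_prod_le_iff.2 ⟨by simp; linarith, by simp; linarith⟩
          have hMn : 0 ≤ 1 + M := (norm_nonneg _).trans hn
          have hs : (a, y' a) = z + (a - z.1) • ((1 : ℝ), F d) := by
            rw [hlt a hat]; ext <;> simp [hA]
          have hd1 : dist (a, y' a) z ≤ δ * (1 + M) := by
            rw [hs, dist_eq_norm, add_sub_cancel_left, norm_smul, Real.norm_eq_abs,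
              abs_of_nonneg (by linarith [ha.1])]
            exact mul_le_mul (by linarith) hn (norm_nonneg _) (by linarith)
          have := dist_triangle (a, y' a) z d
          nlinarith
        · have hd' : HasDerivAt A (F d) a := by
            have := (((hasDerivAt_id a).sub_const z.1).smul_const (F d)).const_add z.2
            rwa [one_smul] at this
          refine (hd'.congr_of_eventuallyEq ?_).hasDerivWithinAt
          filter_upwards [Iio_mem_nhds hat] with b hb using hlt b hb
      · obtain ⟨d', hd', hdist, hder⟩ := h5 a ⟨hat, ha.2⟩
        refine ⟨d', hd', by rwa [hge a hat], ?_⟩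
        exact hder.congr (fun b hb => hge b (hat.trans hb)) (hge a hat)

theorem norm_image_sub_sub_smul_le_of_deriv_right {y : ℝ → E} {v : E} {lo hi c : ℝ} (hlh : lo ≤ hi)
    (hy : ContinuousOn y (Icc lo hi))
    (hd : ∀ a ∈ Ico lo hi, ∃ w, HasDerivWithinAt y w (Ici a) a ∧ ‖w - v‖ ≤ c) :
    ‖y hi - y lo - (hi - lo) • v‖ ≤ c * (hi - lo) := by
  choose! w hw hwc using hd
  have := norm_image_sub_le_of_norm_deriv_right_le_segment (f := fun a => y a - a • v)
    (f' := fun a => w a - v) (C := c) (hy.sub (by fun_prop))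
    (fun a ha => (hw a ha).sub (by simpa using ((hasDerivAt_id a).smul_const v).hasDerivWithinAt))
    hwc hi ⟨hlh, le_rfl⟩
  convert this using 2
  rw [sub_smul]; abel

/-- Euler chains converge to solutions: along an ultrafilter, the polygons of chains with step
sizes `δ k → 0` that start near `(0, x₀)` and end near `(T, q k)` converge pointwise to a solution
that remains in the compact set `X`. Pointwise limits suffice because the estimate
`‖y b - y a - (b - a) • F (a, y a)‖ ≤ η |b - a|` passes to them, and compactness of `X` provides
them without a diagonal argument. -/
theorem exists_solution_of_eulerReach {ι : Type*} (U : Ultrafilter ι) {T : ℝ} (hT : 0 < T)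
    {X : Set E} (hX : IsCompact X) (hF : ContinuousOn F (Icc 0 T ×ˢ X)) {x₀ : E} {δ : ι → ℝ}
    (hδ : Tendsto δ U (𝓝 0)) {z : ι → ℝ × E} (hz : Tendsto z U (𝓝 (0, x₀))) {q : ι → E}
    (hq : ∀ k, q k ∈ X) (h : ∀ k, EulerReach F (Icc 0 T ×ˢ X) (δ k) (T, q k) (z k)) :
    ∃ y : ℝ → E, y 0 = x₀ ∧
      (∀ t ∈ Icc 0 T, HasDerivWithinAt y (F (t, y t)) (Icc 0 T) t) ∧ Tendsto q U (𝓝 (y T)) := by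
  obtain ⟨M, hM⟩ := (isCompact_Icc.prod hX).exists_bound_of_continuousOn hF
  choose t₁ y hst hys hyc hye hyd using fun k => (h k).exists_curve hM
  have hδ0 : ∀ k, 0 < δ k := fun k => dist_nonneg.trans_lt (hye k)
  obtain ⟨k₀⟩ : Nonempty ι := (U : Filter ι).nonempty_of_neBot
  have hM0 : 0 ≤ M := (norm_nonneg _).trans (hM (0, q k₀) ⟨⟨le_rfl, hT.le⟩, hq k₀⟩)
  have hs : Tendsto (fun k => (z k).1) U (𝓝 0) := (continuous_fst.tendsto _).comp hz
  have hx : Tendsto (fun k => (z k).2) U (𝓝 x₀) := (continuous_snd.tendsto _).comp hz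
  have ht₁ : Tendsto t₁ U (𝓝 T) := by
    refine tendsto_iff_dist_tendsto_zero.2 (squeeze_zero (fun _ => dist_nonneg) (fun k => ?_) hδ)
    exact ((le_max_left _ _).trans (Prod.dist_eq (x := (t₁ k, y k (t₁ k)))).ge).trans (hye k).le
  have hCδ : Tendsto (fun k => (2 + M) * δ k) U (𝓝 0) := by simpa using hδ.const_mul (2 + M)
  -- times are clamped to the domain `[(z k).1, t₁ k]` of the `k`-th polygon
  set cl : ι → ℝ → ℝ := fun k a => max (z k).1 (min a (t₁ k)) with hcl
  have hclm : ∀ k a, cl k a ∈ Icc (z k).1 (t₁ k) := fun k a =>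
    ⟨le_max_left _ _, max_le (hst k) (min_le_right _ _)⟩
  have hclt : ∀ a ∈ Icc 0 T, Tendsto (fun k => cl k a) U (𝓝 a) := by
    intro a ha
    have := hs.max ((tendsto_const_nhds (x := a)).min ht₁)
    rwa [min_eq_left ha.2, max_eq_right ha.1] at this
  have hlip : ∀ k, ∀ a ∈ Icc (z k).1 (t₁ k), ∀ b ∈ Icc (z k).1 (t₁ k),
      ‖y k b - y k a‖ ≤ M * |b - a| := by
    intro k
    have key : ∀ a ∈ Icc (z k).1 (t₁ k), ∀ b ∈ Icc (z k).1 (t₁ k), a ≤ b →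
        ‖y k b - y k a‖ ≤ M * (b - a) := by
      intro a ha b hb hab
      simpa using norm_image_sub_sub_smul_le_of_deriv_right (v := 0) (c := M) hab
        ((hyc k).mono (Icc_subset_Icc ha.1 hb.2)) fun c hc => by
          obtain ⟨d, hd, -, hder⟩ := hyd k c ⟨ha.1.trans hc.1, hc.2.trans_le hb.2⟩
          exact ⟨_, hder, by simpa using hM d hd⟩
    intro a ha b hb
    rcases le_total a b with hab | hab
    · rw [abs_of_nonneg (by linarith)]; exact key a ha b hb hab
    · rw [norm_sub_rev, abs_sub_comm, abs_of_nonneg (by linarith)]; exact key b hb a ha hab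
  have hnear : ∀ k a, ∃ p ∈ X, dist (y k (cl k a)) p ≤ (2 + M) * δ k := by
    intro k a
    rcases (hclm k a).2.lt_or_eq with hlt | heq
    · obtain ⟨d, hd, hdist, -⟩ := hyd k _ ⟨(hclm k a).1, hlt⟩
      exact ⟨d.2, hd.2, (le_max_right _ _).trans hdist⟩
    · refine ⟨q k, hq k, ?_⟩
      rw [heq]
      have h1 : dist (y k (t₁ k)) (q k) ≤ δ k := (le_max_right _ _).trans (hye k).le
      have := hδ0 k
      nlinarith
  choose p hpX hp using hnear
  have hlim : ∀ a, ∃ Y ∈ X, Tendsto (fun k => p k a) U (𝓝 Y) := fun a =>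
    hX.ultrafilter_le_nhds (U.map fun k => p k a)
      (tendsto_principal.2 (Eventually.of_forall fun k => hpX k a))
  choose Y hYX hpY using hlim
  have hyY : ∀ a, Tendsto (fun k => y k (cl k a)) U (𝓝 (Y a)) := fun a =>
    (hpY a).congr_dist (squeeze_zero (fun _ => dist_nonneg)
      (fun k => by rw [dist_comm]; exact hp k a) hCδ)
  refine ⟨Y, ?_, ?_, ?_⟩
  · have h0 := hclt 0 ⟨le_rfl, hT.le⟩
    have hd : Tendsto (fun k => M * |cl k 0 - (z k).1|) U (𝓝 0) := by
      simpa using ((h0.sub hs).abs).const_mul M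
    refine tendsto_nhds_unique (hyY 0) (hx.congr_dist (squeeze_zero (fun _ => dist_nonneg)
      (fun k => ?_) hd))
    rw [dist_comm, dist_eq_norm, ← hys k]
    exact hlip k _ ⟨le_rfl, hst k⟩ _ (hclm k 0)
  · intro a ha
    rw [hasDerivWithinAt_iff_isLittleO, Asymptotics.isLittleO_iff]
    intro c hc
    obtain ⟨ρ, hρ, hFρ⟩ := Metric.continuousOn_iff.1 hF (a, Y a) ⟨ha, hYX a⟩ c hc
    set r := ρ / (4 * (M + 1)) with hr
    have hr0 : 0 < r := by positivity
    have hrM : (M + 1) * r = ρ / 4 := by rw [hr]; field_simp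
    filter_upwards [self_mem_nhdsWithin, mem_nhdsWithin_of_mem_nhds (Metric.ball_mem_nhds a hr0)]
      with b hb hbr
    have hba := ((hclt b hb).sub (hclt a ha))
    have hbr' : |b - a| < r := hbr
    refine le_of_tendsto_of_tendsto
      (((hyY b).sub (hyY a)).sub (hba.smul_const (F (a, Y a)))).norm (hba.norm.const_mul c) ?_
    filter_upwards [hba.abs.eventually_lt_const hbr',
      (tendsto_iff_dist_tendsto_zero.1 (hyY a)).eventually_lt_const (show (0 : ℝ) < ρ / 4 by linarith),
      (tendsto_iff_dist_tendsto_zero.1 (hclt a ha)).eventually_lt_const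
        (show (0 : ℝ) < ρ / 4 by linarith),
      hCδ.eventually_lt_const (show (0 : ℝ) < ρ / 4 by linarith)] with k hk1 hk2 hk3 hk4
    have key : ∀ s ∈ Ico (z k).1 (t₁ k), |s - cl k a| ≤ |cl k b - cl k a| →
        ∃ w, HasDerivWithinAt (y k) w (Ici s) s ∧ ‖w - F (a, Y a)‖ ≤ c := by
      intro s hs hsa
      obtain ⟨d, hd, hdist, hder⟩ := hyd k s hs
      refine ⟨_, hder, ?_⟩
      rw [← dist_eq_norm]
      refine (hFρ d hd ?_).le
      have e1 : dist (s, y k s) (cl k a, y k (cl k a)) ≤ (M + 1) * r := by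
        have := hlip k _ (hclm k a) s ⟨hs.1, hs.2.le⟩
        have h0 := abs_nonneg (s - cl k a)
        rw [Prod.dist_eq]
        refine max_le ?_ ?_
        · rw [Real.dist_eq]; nlinarith
        · rw [dist_eq_norm]; nlinarith
      have e2 : dist (cl k a, y k (cl k a)) (a, Y a) < ρ / 4 := by
        rw [Prod.dist_eq]; exact max_lt hk3 hk2
      have := dist_triangle4 d (s, y k s) (cl k a, y k (cl k a)) (a, Y a)
      rw [dist_comm d (s, y k s)] at this
      linarith
    rcases le_total (cl k a) (cl k b) with hab | hab
    · rw [Real.norm_eq_abs, abs_of_nonneg (sub_nonneg.2 hab)]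
      refine norm_image_sub_sub_smul_le_of_deriv_right hab
        ((hyc k).mono (Icc_subset_Icc (hclm k a).1 (hclm k b).2)) fun s hs => ?_
      refine key s ⟨(hclm k a).1.trans hs.1, hs.2.trans_le (hclm k b).2⟩ ?_
      rw [abs_of_nonneg (by linarith [hs.1]), abs_of_nonneg (by linarith)]
      linarith [hs.2]
    · rw [Real.norm_eq_abs, abs_sub_comm, abs_of_nonneg (sub_nonneg.2 hab), ← norm_neg]
      have := norm_image_sub_sub_smul_le_of_deriv_right (v := F (a, Y a)) (c := c) hab
        ((hyc k).mono (Icc_subset_Icc (hclm k b).1 (hclm k a).2)) fun s hs => by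
          refine key s ⟨(hclm k b).1.trans hs.1, hs.2.trans_le (hclm k a).2⟩ ?_
          rw [abs_of_nonpos (by linarith [hs.2]), abs_of_nonpos (by linarith)]
          linarith [hs.1]
      refine (le_of_eq (congrArg norm ?_)).trans this
      rw [sub_smul, sub_smul]; abel
  · have h0 := hclt T ⟨hT.le, le_rfl⟩
    have hd : Tendsto (fun k => M * |cl k T - t₁ k| + δ k) U (𝓝 0) := by
      simpa using (((h0.sub ht₁).abs).const_mul M).add hδ
    refine (hyY T).congr_dist (squeeze_zero (fun _ => dist_nonneg) (fun k => ?_) hd)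
    refine (dist_triangle _ (y k (t₁ k)) _).trans (add_le_add ?_ ?_)
    · rw [dist_eq_norm]
      exact hlip k _ ⟨hst k, le_rfl⟩ _ (hclm k T)
    · exact (le_max_right _ _).trans (hye k).le

/-- If all solutions from `x₀` that stay in `X` agree at time `T`, then fine Euler chains from near
`(0, x₀)` end near their common value. -/
theorem exists_forall_eulerReach_mem {T : ℝ} (hT : 0 < T) {X : Set E} (hX : IsCompact X)
    (hF : ContinuousOn F (Icc 0 T ×ˢ X)) {x₀ p : E}
    (huniq : ∀ y : ℝ → E, y 0 = x₀ →
      (∀ t ∈ Icc 0 T, HasDerivWithinAt y (F (t, y t)) (Icc 0 T) t) → y T = p)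
    {N : Set E} (hN : N ∈ 𝓝 p) :
    ∃ δ > 0, ∀ z : ℝ × E, dist z (0, x₀) < δ → ∀ q ∈ X,
      EulerReach F (Icc 0 T ×ˢ X) δ (T, q) z → q ∈ N := by
  by_contra! hcon
  choose z hz q hq hr hqN using fun k : ℕ => hcon (1 / ((k : ℝ) + 1)) (by positivity)
  have hδ : Tendsto (fun k : ℕ => 1 / ((k : ℝ) + 1)) (hyperfilter ℕ : Filter ℕ) (𝓝 0) :=
    tendsto_one_div_add_atTop_nhds_zero_nat.mono_left Nat.hyperfilter_le_atTop
  have hz' : Tendsto z (hyperfilter ℕ : Filter ℕ) (𝓝 (0, x₀)) :=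
    tendsto_iff_dist_tendsto_zero.2 (squeeze_zero (fun _ => dist_nonneg) (fun k => (hz k).le) hδ)
  obtain ⟨y, hy0, hy, hyT⟩ := exists_solution_of_eulerReach (hyperfilter ℕ) hT hX hF hδ hz' hq hr
  rw [huniq y hy0 hy] at hyT
  obtain ⟨k, hk⟩ := (hyT.eventually hN).exists
  exact hqN k hk

end EulerChains

/-! ### Mollification -/

section Mollification

variable {Z : Type*} [NormedAddCommGroup Z] [NormedSpace ℝ Z] [FiniteDimensional ℝ Z]
  [MeasurableSpace Z] [BorelSpace Z]

/-- Mollification keeps one-sided bounds, and monotonicity under a fixed translation. -/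
theorem exists_contDiff_mollification {V : Z → ℝ} (hV : Measurable V) {C : ℝ}
    (hC : ∀ z, |V z| ≤ C) {δ : ℝ} (hδ : 0 < δ) :
    ∃ v : Z → ℝ, ContDiff ℝ 1 v ∧ (∀ z c, (∀ u, dist u z < δ → c ≤ V u) → c ≤ v z) ∧
      (∀ z c, (∀ u, dist u z < δ → V u ≤ c) → v z ≤ c) ∧
      ∀ z w, (∀ u, dist u z < δ → V (u + w) ≤ V u) → v (z + w) ≤ v z := by
  let μ : Measure Z := Measure.addHaar
  let φ : ContDiffBump (0 : Z) := ⟨δ / 2, δ, half_pos hδ, half_lt_self hδ⟩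
  have hloc : LocallyIntegrable V μ := by
    refine (locallyIntegrable_const C).mono hV.aestronglyMeasurable (Eventually.of_forall fun z => ?_)
    simpa using (hC z).trans (le_abs_self C)
  have hint : ∀ z, Integrable (fun t => φ.normed μ t * V (z - t)) μ := by
    intro z
    refine φ.integrable_normed.mul_bdd (c := C) ?_ (Eventually.of_forall fun t => by
      simpa using hC (z - t))
    exact (hV.comp (measurable_const.sub measurable_id)).aestronglyMeasurable
  have hmono : ∀ (z : Z) (a b : Z → ℝ), Integrable (fun t => φ.normed μ t * a t) μ →
      Integrable (fun t => φ.normed μ t * b t) μ →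
      (∀ t, dist (z - t) z < δ → a t ≤ b t) →
      ∫ t, φ.normed μ t * a t ∂μ ≤ ∫ t, φ.normed μ t * b t ∂μ := by
    intro z a b ha hb hab
    refine integral_mono ha hb fun t => ?_
    by_cases ht : dist (z - t) z < δ
    · exact mul_le_mul_of_nonneg_left (hab t ht) (φ.nonneg_normed t)
    · have h0 : φ.normed μ t = 0 := by
        rw [← Function.notMem_support, φ.support_normed_eq]
        simpa using ht
      simp [h0]
  -- constants are fixed by the mollifier, which reduces all the claims to `hmono`
  have hconst : ∀ c : ℝ, ∫ t, φ.normed μ t * c ∂μ = c := fun c => by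
    rw [integral_mul_const, φ.integral_normed, one_mul]
  refine ⟨fun z => ∫ t, φ.normed μ t * V (z - t) ∂μ, ?_, ?_, ?_, ?_⟩
  · exact φ.hasCompactSupport_normed.contDiff_convolution_left (ContinuousLinearMap.mul ℝ ℝ)
      (n := 1) (φ.contDiff_normed (n := 1)) hloc
  · intro z c h
    rw [← hconst c]
    exact hmono z _ _ (φ.integrable_normed.mul_const c) (hint z) fun t ht => h _ ht
  · intro z c h
    conv_rhs => rw [← hconst c]
    exact hmono z _ _ (hint z) (φ.integrable_normed.mul_const c) fun t ht => h _ ht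
  · intro z w h
    refine hmono z _ _ (hint (z + w)) (hint z) fun t ht => ?_
    rw [add_sub_right_comm]
    exact h _ ht

end Mollification

theorem bddAbove_insert_image {α : Type*} {X : Set α} {g : α → ℝ} {G : ℝ}
    (hG : ∀ x ∈ X, |g x| ≤ G) (P : α → Prop) :
    BddAbove (insert (-G) (g '' {q ∈ X | P q})) := by
  refine ⟨|G|, ?_⟩
  rintro _ (rfl | ⟨q, ⟨hq, -⟩, rfl⟩)
  · exact neg_le_abs G
  · exact ((le_abs_self _).trans (hG q hq)).trans (le_abs_self G)

/-! ### The value function of the Euler chains -/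

section ValueFunction

variable {E : Type*} [NormedAddCommGroup E] [NormedSpace ℝ E]

/-- The value function of the Euler chains: the supremum of `g q` over all `q ∈ X` such that
`(T, q)` can be reached from `z`, and `-G` if there is none. -/
noncomputable def eulerValue (F : ℝ × E → E) (T : ℝ) (X : Set E) (g : E → ℝ) (G δ : ℝ)
    (z : ℝ × E) : ℝ :=
  sSup (insert (-G) (g '' {q ∈ X | EulerReach F (Icc 0 T ×ˢ X) δ (T, q) z}))

variable {F : ℝ × E → E} {T : ℝ} {X : Set E} {g : E → ℝ} {G δ : ℝ}

theorem eulerValue_le {z : ℝ × E} {c : ℝ} (hc : -G ≤ c)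
    (h : ∀ q ∈ X, EulerReach F (Icc 0 T ×ˢ X) δ (T, q) z → g q ≤ c) :
    eulerValue F T X g G δ z ≤ c := by
  refine csSup_le (insert_nonempty _ _) ?_
  rintro _ (rfl | ⟨q, ⟨hq, hr⟩, rfl⟩)
  · exact hc
  · exact h q hq hr

theorem le_eulerValue (hG : ∀ x ∈ X, |g x| ≤ G) {z : ℝ × E} {q : E} (hq : q ∈ X)
    (hr : EulerReach F (Icc 0 T ×ˢ X) δ (T, q) z) : g q ≤ eulerValue F T X g G δ z :=
  le_csSup (bddAbove_insert_image hG _) (.inr ⟨q, ⟨hq, hr⟩, rfl⟩)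

theorem neg_le_eulerValue (hG : ∀ x ∈ X, |g x| ≤ G) (z : ℝ × E) :
    -G ≤ eulerValue F T X g G δ z :=
  le_csSup (bddAbove_insert_image hG _) (.inl rfl)

theorem abs_eulerValue_le (hG : ∀ x ∈ X, |g x| ≤ G) (hG0 : 0 ≤ G) (z : ℝ × E) :
    |eulerValue F T X g G δ z| ≤ G :=
  abs_le.2 ⟨neg_le_eulerValue hG z, eulerValue_le (by linarith) fun q hq _ =>
    (le_abs_self _).trans (hG q hq)⟩

theorem eulerValue_add_smul_le (hG : ∀ x ∈ X, |g x| ≤ G) {u d : ℝ × E} (hd : d ∈ Icc 0 T ×ˢ X)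
    (hu : dist u d < δ) {τ : ℝ} (hτ : 0 < τ) (hτδ : τ < δ) :
    eulerValue F T X g G δ (u + τ • ((1 : ℝ), F d)) ≤ eulerValue F T X g G δ u :=
  eulerValue_le (neg_le_eulerValue hG u) fun _ hq hr =>
    le_eulerValue hG hq (.step u d τ hd hu hτ hτδ hr)

theorem lowerSemicontinuous_eulerValue (hG : ∀ x ∈ X, |g x| ≤ G) :
    LowerSemicontinuous (eulerValue F T X g G δ) := by
  intro z a ha
  obtain ⟨_, rfl | ⟨q, ⟨hq, hr⟩, rfl⟩, hb⟩ := exists_lt_of_lt_csSup (insert_nonempty _ _) ha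
  · exact Eventually.of_forall fun u => hb.trans_le (neg_le_eulerValue hG u)
  · filter_upwards [isOpen_setOf_eulerReach.mem_nhds hr] with u hu
    exact hb.trans_le (le_eulerValue hG hq hu)

end ValueFunction

/-! ### Supersolutions and trajectories -/

section Supersolutions

variable {n : ℕ} {f : ℝ → EuclideanSpace ℝ (Fin n) → EuclideanSpace ℝ (Fin n)}

theorem lieDerivative_eq_fderiv {v : ℝ × EuclideanSpace ℝ (Fin n) → ℝ} {t : ℝ}
    {x : EuclideanSpace ℝ (Fin n)} (hv : DifferentiableAt ℝ v (t, x)) :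
    lieDerivative f v t x = fderiv ℝ v (t, x) (1, f t x) := by
  have h1 : HasDerivAt (fun s => v (s, x)) (fderiv ℝ v (t, x) (1, 0)) t :=
    HasFDerivAt.comp_hasDerivAt t (f := fun s : ℝ => (s, x)) hv.hasFDerivAt
      ((hasDerivAt_id t).prodMk (hasDerivAt_const t x))
  have h2 : HasFDerivAt (fun y => v (t, y))
      ((fderiv ℝ v (t, x)).comp (ContinuousLinearMap.inr ℝ ℝ _)) x :=
    HasFDerivAt.comp x (f := fun y => (t, y)) hv.hasFDerivAt (hasFDerivAt_prodMk_right t x)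
  rw [lieDerivative, h1.deriv, inner_gradient_right, h2.fderiv]
  simp [← map_add]

theorem lieDerivative_nonpos_of_add_smul_le {v : ℝ × EuclideanSpace ℝ (Fin n) → ℝ} {t δ : ℝ}
    {x : EuclideanSpace ℝ (Fin n)} (hv : DifferentiableAt ℝ v (t, x)) (hδ : 0 < δ)
    (h : ∀ τ, 0 < τ → τ < δ → v ((t, x) + τ • ((1 : ℝ), f t x)) ≤ v (t, x)) :
    lieDerivative f v t x ≤ 0 := by
  rw [lieDerivative_eq_fderiv hv]
  have hd : HasDerivAt (fun τ : ℝ => v ((t, x) + τ • ((1 : ℝ), f t x)))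
      (fderiv ℝ v (t, x) (1, f t x)) 0 := hv.hasFDerivAt.hasLineDerivAt _
  have := hd.tendsto_slope_zero_right
  refine le_of_tendsto this ?_
  filter_upwards [Ioo_mem_nhdsGT hδ] with τ hτ
  have := h τ hτ.1 hτ.2
  simp only [zero_add, zero_smul, add_zero, smul_eq_mul]
  exact mul_nonpos_of_nonneg_of_nonpos (inv_nonneg.2 hτ.1.le) (by linarith)

/-- The mollified Euler value function is a smooth supersolution. Mollifying at the parameter `δ`
of the chains costs nothing: at each point of the `δ`-ball around `(t, x)` a step with velocity
`f t x` is allowed, so the value function decreases along that direction on all of it. -/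
theorem exists_supersolution {T : ℝ} {X : Set (EuclideanSpace ℝ (Fin n))}
    {g : EuclideanSpace ℝ (Fin n) → ℝ} {G δ : ℝ} (hG : ∀ x ∈ X, |g x| ≤ G) (hG0 : 0 ≤ G)
    (hδ : 0 < δ) :
    ∃ v : ℝ × EuclideanSpace ℝ (Fin n) → ℝ, ContDiff ℝ 1 v ∧
      (∀ t ∈ Icc 0 T, ∀ x ∈ X, lieDerivative f v t x ≤ 0) ∧ (∀ x ∈ X, g x ≤ v (T, x)) ∧
      ∀ z c, (∀ u, dist u z < δ → eulerValue (fun p => f p.1 p.2) T X g G δ u ≤ c) →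
        v z ≤ c := by
  obtain ⟨v, hv, hlo, hup, hstep⟩ := exists_contDiff_mollification
    (lowerSemicontinuous_eulerValue (F := fun p => f p.1 p.2) (T := T) (δ := δ) hG).measurable
    (abs_eulerValue_le hG hG0) hδ
  refine ⟨v, hv, fun t ht x hx => ?_, fun x hx => ?_, hup⟩
  · exact lieDerivative_nonpos_of_add_smul_le (hv.differentiable one_ne_zero _) hδ
      fun τ hτ hτδ => hstep _ _ fun u hu => eulerValue_add_smul_le (d := (t, x)) hG ⟨ht, hx⟩ hu hτ hτδ
  · exact hlo _ _ fun u hu => le_eulerValue hG hx (.base u hu)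

theorem flow_zero (hf : WellPosed f) (x₀ : EuclideanSpace ℝ (Fin n)) : flow hf 0 x₀ = x₀ :=
  (hf x₀).choose_spec.1.1

theorem hasDerivWithinAt_flow (hf : WellPosed f) (x₀ : EuclideanSpace ℝ (Fin n)) {t : ℝ}
    (ht : 0 ≤ t) : HasDerivWithinAt (fun s => flow hf s x₀) (f t (flow hf t x₀)) (Ici 0) t :=
  (hf x₀).choose_spec.1.2 t ht

theorem eq_flow_of_isSolutionOn (hf : WellPosed f) {x₀ : EuclideanSpace ℝ (Fin n)} {T : ℝ}
    (hT : 0 < T) {y : ℝ → EuclideanSpace ℝ (Fin n)} (hy : IsSolutionOn f x₀ (Icc 0 T) y) :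
    y T = flow hf T x₀ :=
  (hf x₀).choose_spec.2 T hT y hy ⟨hT.le, le_rfl⟩

/-- Supersolutions decrease along trajectories. -/
theorem apply_flow_le_of_lieDerivative_nonpos (hf : WellPosed f) {T : ℝ} (hT : 0 < T)
    {X : Set (EuclideanSpace ℝ (Fin n))} {x₀ : EuclideanSpace ℝ (Fin n)}
    (hX : ∀ t ∈ Icc 0 T, flow hf t x₀ ∈ X) {v : ℝ × EuclideanSpace ℝ (Fin n) → ℝ}
    (hv : IsC1On v (Icc 0 T ×ˢ X)) (hL : ∀ t ∈ Icc 0 T, ∀ x ∈ X, lieDerivative f v t x ≤ 0) :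
    v (T, flow hf T x₀) ≤ v (0, x₀) := by
  obtain ⟨U, hU, hDU, hvU⟩ := hv
  have hdiff : ∀ t ∈ Icc 0 T, DifferentiableAt ℝ v (t, flow hf t x₀) := fun t ht =>
    (hvU.differentiableOn one_ne_zero).differentiableAt (hU.mem_nhds (hDU ⟨ht, hX t ht⟩))
  have hcont : ContinuousOn (fun t => v (t, flow hf t x₀)) (Icc 0 T) := by
    intro t ht
    refine (hdiff t ht).continuousAt.comp_continuousWithinAt (f := fun t => (t, flow hf t x₀)) ?_
    exact continuousWithinAt_id.prodMk
      ((hasDerivWithinAt_flow hf x₀ ht.1).continuousWithinAt.mono Icc_subset_Ici_self)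
  have hder : ∀ t ∈ interior (Icc 0 T), HasDerivAt (fun t => v (t, flow hf t x₀))
      (lieDerivative f v t (flow hf t x₀)) t := by
    intro t ht
    have ht' := interior_subset ht
    rw [interior_Icc] at ht
    rw [lieDerivative_eq_fderiv (hdiff t ht')]
    exact HasFDerivAt.comp_hasDerivAt t (f := fun t => (t, flow hf t x₀)) (hdiff t ht').hasFDerivAt
      ((hasDerivAt_id t).prodMk ((hasDerivWithinAt_flow hf x₀ ht'.1).hasDerivAt
        (Ici_mem_nhds ht.1)))
  have := antitoneOn_of_deriv_nonpos (convex_Icc 0 T) hcont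
    (fun t ht => (hder t ht).differentiableAt.differentiableWithinAt)
    (fun t ht => by
      rw [(hder t ht).deriv]
      exact hL t (interior_subset ht) _ (hX t (interior_subset ht)))
    ⟨le_rfl, hT.le⟩ ⟨hT.le, le_rfl⟩ hT.le
  simpa [flow_zero] using this

section Trajectories

variable (hf : WellPosed f) {T : ℝ} (hT : 0 < T) {X₀ X : Set (EuclideanSpace ℝ (Fin n))}
  (hX : ∀ x₀ ∈ X₀, ∀ t ∈ Icc 0 T, flow hf t x₀ ∈ X)
  (hfc : ContinuousOn (fun p : ℝ × EuclideanSpace ℝ (Fin n) => f p.1 p.2) (Icc 0 T ×ˢ X))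
  (hXK : IsCompact X)

include hT hX hfc hXK

/-- Near `(0, x₀)` the Euler value function is almost bounded by the payoff of the trajectory of
`x₀`. The same `δ` serves as parameter of the chains and as radius of the neighbourhood. -/
theorem exists_eulerValue_le {g : EuclideanSpace ℝ (Fin n) → ℝ} (hgc : ContinuousOn g X) {G : ℝ}
    (hG : ∀ x ∈ X, |g x| ≤ G) {x₀ : EuclideanSpace ℝ (Fin n)} (hx₀ : x₀ ∈ X₀) {η : ℝ}
    (hη : 0 < η) :
    ∃ δ > 0, ∀ z, dist z (0, x₀) < δ →
      eulerValue (fun p => f p.1 p.2) T X g G δ z ≤ g (flow hf T x₀) + η := by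
  have hmem : flow hf T x₀ ∈ X := hX x₀ hx₀ T ⟨hT.le, le_rfl⟩
  have hN := hgc _ hmem (Iio_mem_nhds (lt_add_of_pos_right (g (flow hf T x₀)) hη))
  obtain ⟨N, hN, hNs⟩ := mem_nhdsWithin_iff_exists_mem_nhds_inter.1 hN
  obtain ⟨δ, hδ, h⟩ := exists_forall_eulerReach_mem hT hXK hfc
    (fun y hy0 hy => eq_flow_of_isSolutionOn hf hT ⟨hy0, hy⟩) hN
  refine ⟨δ, hδ, fun z hz => eulerValue_le ?_ fun q hq hr => ?_⟩
  · linarith [(abs_le.1 (hG _ hmem)).1]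
  · exact le_of_lt (hNs ⟨h z hz q hq hr, hq⟩)

/-- Upper semicontinuity of the terminal payoff on `X₀`. -/
theorem eventually_flow_le {g : EuclideanSpace ℝ (Fin n) → ℝ} (hgc : ContinuousOn g X)
    {x₀ : EuclideanSpace ℝ (Fin n)} (hx₀ : x₀ ∈ X₀) {η : ℝ} (hη : 0 < η) :
    ∀ᶠ x in 𝓝[X₀] x₀, g (flow hf T x) ≤ g (flow hf T x₀) + η := by
  obtain ⟨G, hG⟩ := hXK.exists_bound_of_continuousOn hgc
  have hG0 : 0 ≤ G := (norm_nonneg _).trans (hG _ (hX x₀ hx₀ T ⟨hT.le, le_rfl⟩))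
  obtain ⟨δ, hδ, h⟩ := exists_eulerValue_le hf hT hX hfc hXK hgc hG hx₀ hη
  obtain ⟨v, hv, hL, hfin, hup⟩ := exists_supersolution (f := f) (T := T) hG hG0 (half_pos hδ)
  filter_upwards [self_mem_nhdsWithin,
    mem_nhdsWithin_of_mem_nhds (Metric.ball_mem_nhds x₀ (half_pos hδ))] with x hx hxd
  have hvx := apply_flow_le_of_lieDerivative_nonpos hf hT (hX x hx)
    ⟨univ, isOpen_univ, subset_univ _, hv.contDiffOn⟩ hL
  refine ((hfin _ (hX x hx T ⟨hT.le, le_rfl⟩)).trans hvx).trans (hup _ _ fun u hu => ?_)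
  have hd : dist ((0 : ℝ), x) (0, x₀) < δ / 2 := by
    rw [Prod.dist_eq, dist_self]; exact max_lt (half_pos hδ) hxd
  have hu' : dist u (0, x₀) < δ := (dist_triangle _ _ _).trans_lt (by linarith)
  refine (eulerValue_le (neg_le_eulerValue hG u) fun q hq hr => ?_).trans (h u hu')
  exact le_eulerValue hG hq (hr.mono (by linarith))

/-- The terminal payoff depends continuously on the initial state. Trajectories lie below every
supersolution, which gives upper semicontinuity; applied to `-g` it gives the other half. -/
theorem continuousOn_comp_flow {g : EuclideanSpace ℝ (Fin n) → ℝ} (hgc : ContinuousOn g X) :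
    ContinuousOn (fun x => g (flow hf T x)) X₀ := by
  intro x₀ hx₀
  refine Metric.tendsto_nhds.2 fun η hη => ?_
  filter_upwards [eventually_flow_le hf hT hX hfc hXK hgc hx₀ (half_pos hη),
    eventually_flow_le hf hT hX hfc hXK hgc.neg hx₀ (half_pos hη)] with x h1 h2
  simp only [Pi.neg_apply] at h2
  rw [Real.dist_eq, abs_lt]
  constructor <;> linarith

/-- The pointwise bounds near the compact set `{0} × X₀` combine to a uniform one, so that a single
supersolution is uniformly close to the terminal payoff. -/
theorem exists_supersolution_initial_le (hX₀K : IsCompact X₀)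
    {g : EuclideanSpace ℝ (Fin n) → ℝ} (hgc : ContinuousOn g X) {η : ℝ} (hη : 0 < η) :
    ∃ v : ℝ × EuclideanSpace ℝ (Fin n) → ℝ, ContDiff ℝ 1 v ∧
      (∀ t ∈ Icc 0 T, ∀ x ∈ X, lieDerivative f v t x ≤ 0) ∧ (∀ x ∈ X, g x ≤ v (T, x)) ∧
      ∀ x ∈ X₀, v (0, x) ≤ g (flow hf T x) + η := by
  obtain ⟨G, hG⟩ := hXK.exists_bound_of_continuousOn hgc
  replace hG : ∀ x ∈ X, |g x| ≤ |G| := fun x hx => (hG x hx).trans (le_abs_self G)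
  obtain ⟨δ, hδ, h⟩ : ∃ δ > 0, ∀ x ∈ X₀, ∀ u, dist u ((0 : ℝ), x) < δ →
      eulerValue (fun p => f p.1 p.2) T X g |G| δ u ≤ g (flow hf T x) + η := by
    refine hX₀K.induction_on (p := fun S => ∃ δ > 0, ∀ x ∈ S, ∀ u, dist u ((0 : ℝ), x) < δ →
      eulerValue (fun p => f p.1 p.2) T X g |G| δ u ≤ g (flow hf T x) + η) ?_ ?_ ?_ ?_
    · exact ⟨1, one_pos, by simp⟩
    · rintro s t hst ⟨δ, hδ, h⟩
      exact ⟨δ, hδ, fun x hx => h x (hst hx)⟩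
    · have hmono : ∀ {δ δ' : ℝ} (u : ℝ × EuclideanSpace ℝ (Fin n)), δ ≤ δ' →
          eulerValue (fun p => f p.1 p.2) T X g |G| δ u ≤
            eulerValue (fun p => f p.1 p.2) T X g |G| δ' u := fun u hle =>
        eulerValue_le (neg_le_eulerValue hG u) fun q hq hr => le_eulerValue hG hq (hr.mono hle)
      rintro s t ⟨δ, hδ, h⟩ ⟨δ', hδ', h'⟩
      refine ⟨min δ δ', lt_min hδ hδ', ?_⟩
      rintro x (hx | hx) u hu
      · exact (hmono u (min_le_left _ _)).trans (h x hx u (hu.trans_le (min_le_left _ _)))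
      · exact (hmono u (min_le_right _ _)).trans (h' x hx u (hu.trans_le (min_le_right _ _)))
    · intro x₀ hx₀
      obtain ⟨δ, hδ, h⟩ := exists_eulerValue_le hf hT hX hfc hXK hgc hG hx₀ (half_pos hη)
      have hev : ∀ᶠ x in 𝓝[X₀] x₀, g (flow hf T x₀) - η / 2 < g (flow hf T x) :=
        (continuousOn_comp_flow hf hT hX hfc hXK hgc x₀ hx₀).eventually_const_lt (by linarith)
      refine ⟨_, hev.and (mem_nhdsWithin_of_mem_nhds (Metric.ball_mem_nhds x₀ (half_pos hδ))),
        δ / 2, half_pos hδ, fun x hx u hu => ?_⟩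
      have hd : dist ((0 : ℝ), x) (0, x₀) < δ / 2 := by
        rw [Prod.dist_eq, dist_self]; exact max_lt (half_pos hδ) hx.2
      have hu' : dist u (0, x₀) < δ := (dist_triangle _ _ _).trans_lt (by linarith)
      have h1 := h u hu'
      have h2 : g (flow hf T x₀) - η / 2 < g (flow hf T x) := hx.1
      refine (eulerValue_le (neg_le_eulerValue hG u) fun q hq hr => ?_).trans
        (h1.trans (by linarith))
      exact le_eulerValue hG hq (hr.mono (by linarith))
  obtain ⟨v, hv, hL, hfin, hup⟩ := exists_supersolution (f := f) (T := T) hG (abs_nonneg G) hδ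
  exact ⟨v, hv, hL, hfin, fun x hx => hup _ _ (h x hx)⟩

end Trajectories

end Supersolutions

/-! ### Duality for the moment problem -/

section LinearProgramming

theorem IsCompact.convexHull_of_finiteDimensional {V : Type*} [NormedAddCommGroup V]
    [NormedSpace ℝ V] [FiniteDimensional ℝ V] {S : Set V} (hS : IsCompact S) :
    IsCompact (convexHull ℝ S) := by
  set d := Module.finrank ℝ V + 1
  -- by Carathéodory, points of the hull are combinations of at most `d` points of `S`
  have heq : convexHull ℝ S = ⋃ k ∈ Finset.range (d + 1),
      (fun p : (Fin k → ℝ) × (Fin k → V) => ∑ i, p.1 i • p.2 i) ''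
        (stdSimplex ℝ (Fin k) ×ˢ Set.pi univ fun _ => S) := by
    apply Subset.antisymm
    · intro x hx
      obtain ⟨ι, _, z, w, hz, hind, hw, hw1, hx⟩ := eq_pos_convex_span_of_mem_convexHull hx
      let e := (Fintype.equivFin ι).symm
      have hcard : Fintype.card ι ≤ d :=
        hind.card_le_finrank_succ.trans (Nat.succ_le_succ (Submodule.finrank_le _))
      refine mem_biUnion (x := Fintype.card ι) (by simpa using Nat.lt_succ_of_le hcard)
        ⟨(w ∘ e, z ∘ e), ⟨⟨fun i => (hw _).le, ?_⟩, fun i _ => hz (mem_range_self _)⟩, ?_⟩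
      · exact (e.sum_comp w).trans hw1
      · exact (e.sum_comp fun i => w i • z i).trans hx
    · refine iUnion₂_subset fun k _ => ?_
      rintro _ ⟨⟨w, z⟩, ⟨hw, hz⟩, rfl⟩
      exact (convex_convexHull ℝ S).sum_mem (fun i _ => hw.1 i) hw.2
        fun i _ => subset_convexHull ℝ S (hz i trivial)
  rw [heq]
  refine (Finset.range (d + 1)).isCompact_biUnion fun k _ => ?_
  exact ((isCompact_stdSimplex ℝ (Fin k)).prod (isCompact_univ_pi fun _ => hS)).image (by fun_prop)

/-- Lagrange duality for the moment problem: if no finitely supported probability measure on the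
compact set `K` satisfies the constraints `∫ h ≤ c` and has `∫ F ≥ r`, multipliers certify the bound
`r`. The convex hull of the image of `K` under `(F, h)` is compact, so it can be strictly separated
from `{(a, b) | r ≤ a, b ≤ c}`. A separating hyperplane with nonzero first coefficient gives the
multipliers at once; otherwise it shows the constraints to be infeasible, and large multiples of it
give arbitrarily low bounds. -/
theorem exists_multipliers {α : Type*} [TopologicalSpace α] {m : ℕ} {K : Set α} (hK : IsCompact K)
    {F : α → ℝ} {h : α → Fin m → ℝ} (hF : ContinuousOn F K) (hh : ContinuousOn h K)
    {c : Fin m → ℝ} {r : ℝ}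
    (H : ∀ (ι : Type) [Fintype ι] (w : ι → ℝ) (z : ι → α), (∀ i, 0 ≤ w i) → ∑ i, w i = 1 →
      (∀ i, z i ∈ K) → (∀ j, ∑ i, w i * h (z i) j ≤ c j) → ∑ i, w i * F (z i) < r) :
    ∃ (a : ℝ) (β : Fin m → ℝ), (∀ i, 0 ≤ β i) ∧ (∀ x ∈ K, F x ≤ a + ∑ i, β i * h x i) ∧
      a + ∑ i, β i * c i ≤ r := by
  have hS : IsCompact (convexHull ℝ ((fun x => (F x, h x)) '' K)) :=
    (hK.image_of_continuousOn (hF.prodMk hh)).convexHull_of_finiteDimensional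
  have hdisj : Disjoint (convexHull ℝ ((fun x => (F x, h x)) '' K)) (Ici r ×ˢ Iic c) := by
    rw [Set.disjoint_left]
    rintro ⟨a, b⟩ hab ⟨ha, hb⟩
    obtain ⟨ι, _, w, z, hw, hw1, hz, hsum⟩ := mem_convexHull_iff_exists_fintype.1 hab
    choose x hxK hxz using hz
    have h1 : ∑ i, w i * F (x i) = a := by
      have := congrArg Prod.fst hsum
      simpa [Prod.fst_sum, ← hxz] using this
    have h2 : ∀ j, ∑ i, w i * h (x i) j = b j := fun j => by
      have := congrFun (congrArg Prod.snd hsum) j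
      simpa [Prod.snd_sum, ← hxz] using this
    have := H ι w x hw hw1 hxK fun j => (h2 j).trans_le (hb j)
    rw [h1] at this
    exact absurd ha this.not_ge
  obtain ⟨l, u, v, hlu, huv, hvl⟩ := geometric_hahn_banach_compact_closed (convex_convexHull ℝ _) hS
    ((convex_Ici r).prod (convex_Iic c)) (isClosed_Ici.prod isClosed_Iic) hdisj
  set lam := l (1, 0) with hlam
  set β : Fin m → ℝ := fun i => -l (0, Pi.single i 1) with hβ
  have hl : ∀ a b, l (a, b) = lam * a - ∑ i, β i * b i := by
    intro a b
    have h1 : ((a, b) : ℝ × (Fin m → ℝ)) =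
        a • ((1 : ℝ), 0) + ∑ i, b i • ((0 : ℝ), Pi.single i (1 : ℝ)) := by
      ext j
      · simp [Prod.fst_sum]
      · simp [Prod.snd_sum, Finset.sum_apply, Pi.single_apply]
    rw [h1, map_add, map_smul, map_sum]
    simp only [map_smul, smul_eq_mul, hβ, neg_mul, Finset.sum_neg_distrib, sub_neg_eq_add, hlam]
    rw [mul_comm a]
    exact congrArg _ (Finset.sum_congr rfl fun i _ => mul_comm _ _)
  have hQ : v < lam * r - ∑ i, β i * c i := by
    rw [← hl]; exact hvl (r, c) ⟨self_mem_Ici, self_mem_Iic⟩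
  -- `l` is bounded below on the orthant, hence nonnegative on its recession directions
  have hrec : ∀ e : ℝ × (Fin m → ℝ), 0 ≤ e.1 → e.2 ≤ 0 → 0 ≤ l e := by
    intro e he1 he2
    by_contra! hneg
    -- for this `s` one has `l ((r, c) + s • e) = v`
    set s := (l (r, c) - v) / -l e with hs
    have hs0 : 0 ≤ s := div_nonneg (by rw [hl]; linarith) (by linarith)
    have := hvl ((r, c) + s • e) ⟨?_, ?_⟩
    · rw [map_add, map_smul, smul_eq_mul, hs, div_mul_eq_mul_div, div_neg,
        mul_div_cancel_right₀ _ hneg.ne] at this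
      linarith
    · have := mul_nonneg hs0 he1
      simpa using this
    · have := smul_nonpos_of_nonneg_of_nonpos hs0 he2
      simpa using this
  have hlam0 : 0 ≤ lam := hrec _ zero_le_one le_rfl
  have hβ0 : ∀ i, 0 ≤ β i := fun i => by
    have := hrec (0, -Pi.single i 1) le_rfl (neg_nonpos.2 (Pi.single_nonneg.2 zero_le_one))
    rw [hl] at this
    simpa [Pi.single_apply] using this
  have hK' : ∀ x ∈ K, lam * F x - ∑ i, β i * h x i < u := fun x hx => by
    rw [← hl]; exact hlu _ (subset_convexHull ℝ _ ⟨x, hx, rfl⟩)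
  rcases hlam0.eq_or_lt with h0 | hpos
  -- if `lam = 0`, then `u + ∑ β h > 0` on `K` while `u + ∑ β c < 0`, so adding multiples of
  -- `(u, β)` to the constant bound `G` keeps it a bound and lowers its value arbitrarily
  · obtain ⟨G, hG⟩ := hK.exists_bound_of_continuousOn hF
    set D := -(u + ∑ i, β i * c i) with hD
    have hD0 : 0 < D := by rw [← h0] at hQ; linarith
    set k := |G - r| / D with hk
    have hk0 : 0 ≤ k := by positivity
    have hkD : k * D = |G - r| := div_mul_cancel₀ _ hD0.ne'
    refine ⟨G + k * u, fun i => k * β i, fun i => mul_nonneg hk0 (hβ0 i), fun x hx => ?_, ?_⟩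
    · have h1 := hK' x hx
      rw [← h0] at h1
      have h2 := (le_abs_self _).trans (hG x hx)
      simp only [mul_assoc, ← Finset.mul_sum]
      nlinarith
    · simp only [mul_assoc, ← Finset.mul_sum]
      have := le_abs_self (G - r)
      rw [hD] at hkD
      linarith
  · refine ⟨u / lam, fun i => β i / lam, fun i => div_nonneg (hβ0 i) hpos.le, fun x hx => ?_, ?_⟩
    · simp only [div_mul_eq_mul_div, ← Finset.sum_div]
      rw [← add_div, le_div_iff₀ hpos]
      linarith [hK' x hx]
    · simp only [div_mul_eq_mul_div, ← Finset.sum_div]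
      rw [← add_div, div_le_iff₀ hpos]
      linarith

end LinearProgramming

/-! ### Admissible measures -/

section Duality

variable {n m : ℕ} {X₀ : Set (EuclideanSpace ℝ (Fin n))}
  {h : EuclideanSpace ℝ (Fin n) → Fin m → ℝ} {c : Fin m → ℝ}

theorem setIntegral_le_of_isAdmissible {μ₀ : Measure (EuclideanSpace ℝ (Fin n))}
    (hμ : IsAdmissible X₀ h c μ₀) (hX₀ : MeasurableSet X₀) {F : EuclideanSpace ℝ (Fin n) → ℝ}
    (hF : IntegrableOn F X₀ μ₀) {α : ℝ} {β : Fin m → ℝ} (hβ : ∀ i, 0 ≤ β i)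
    (hle : ∀ x ∈ X₀, F x ≤ α + ∑ i, β i * h x i) :
    ∫ x in X₀, F x ∂μ₀ ≤ α + ∑ i, β i * c i := by
  obtain ⟨hprob, hsupp, hint⟩ := hμ
  have h1 : μ₀.real X₀ = 1 := by
    rw [measureReal_def, (prob_compl_eq_zero_iff hX₀).1 hsupp, ENNReal.toReal_one]
  have hi : ∀ i ∈ Finset.univ, IntegrableOn (fun x => β i * h x i) X₀ μ₀ := fun i _ =>
    (hint i).1.const_mul (β i)
  have hc : IntegrableOn (fun _ => α) X₀ μ₀ := integrable_const α
  calc ∫ x in X₀, F x ∂μ₀ ≤ ∫ x in X₀, (α + ∑ i, β i * h x i) ∂μ₀ :=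
        setIntegral_mono_on hF (hc.add (integrable_finsetSum _ hi)) hX₀ hle
    _ = α + ∑ i, β i * ∫ x in X₀, h x i ∂μ₀ := by
        rw [integral_add hc (integrable_finsetSum _ hi), integral_finsetSum _ hi]
        simp [h1, integral_const_mul]
    _ ≤ α + ∑ i, β i * c i := by
        gcongr with i
        · exact hβ i
        · exact (hint i).2

/-- A finite convex combination of Dirac masses at points of `X₀` is admissible if its moments are
bounded by `c`. -/
theorem exists_isAdmissible_of_sum_le {ι : Type*} [Fintype ι] {w : ι → ℝ}
    {z : ι → EuclideanSpace ℝ (Fin n)} (hX₀ : MeasurableSet X₀) (hw : ∀ i, 0 ≤ w i)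
    (hw1 : ∑ i, w i = 1) (hz : ∀ i, z i ∈ X₀) (hc : ∀ j, ∑ i, w i * h (z i) j ≤ c j) :
    ∃ μ₀ : Measure (EuclideanSpace ℝ (Fin n)), IsAdmissible X₀ h c μ₀ ∧
      ∀ F : EuclideanSpace ℝ (Fin n) → ℝ, ∫ x in X₀, F x ∂μ₀ = ∑ i, w i * F (z i) := by
  set μ₀ : Measure (EuclideanSpace ℝ (Fin n)) :=
    ∑ i, ENNReal.ofReal (w i) • Measure.dirac (z i) with hμ
  have hsupp : μ₀ X₀ᶜ = 0 := by
    simp [hμ, Measure.finsetSum_apply, hX₀.compl, hz]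
  have hres : μ₀.restrict X₀ = μ₀ := Measure.restrict_eq_self_of_ae_mem (by
    rw [ae_iff]; exact hsupp)
  have hI : ∀ F : EuclideanSpace ℝ (Fin n) → ℝ, ∀ i ∈ Finset.univ,
      Integrable F (ENNReal.ofReal (w i) • Measure.dirac (z i)) := fun F i _ =>
    (integrable_dirac (by simp)).smul_measure ENNReal.ofReal_ne_top
  have hint : ∀ F : EuclideanSpace ℝ (Fin n) → ℝ, ∫ x in X₀, F x ∂μ₀ = ∑ i, w i * F (z i) := by
    intro F
    rw [hres, hμ, integral_finsetSum_measure (hI F)]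
    refine Finset.sum_congr rfl fun i _ => ?_
    rw [integral_smul_measure, integral_dirac, ENNReal.toReal_ofReal (hw i), smul_eq_mul]
  refine ⟨μ₀, ⟨⟨?_⟩, hsupp, fun j => ⟨?_, ?_⟩⟩, hint⟩
  · simp only [hμ, Measure.finsetSum_apply, Measure.smul_apply, measure_univ, smul_eq_mul, mul_one]
    rw [← ENNReal.ofReal_sum_of_nonneg fun i _ => hw i, hw1, ENNReal.ofReal_one]
  · rw [IntegrableOn, hres]
    exact integrable_finsetSum_measure.2 (hI _)
  · rw [hint fun x => h x j]
    exact hc j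

end Duality

/-! ### Strong duality -/

theorem mainTheorem1 {n m : ℕ}
    (f : ℝ → EuclideanSpace ℝ (Fin n) → EuclideanSpace ℝ (Fin n)) (hf : WellPosed f)
    (T : ℝ) (hT : 0 < T)
    (X₀ X : Set (EuclideanSpace ℝ (Fin n)))
    (hX : ∀ x₀ ∈ X₀, ∀ t ∈ Icc 0 T, flow hf t x₀ ∈ X)
    (h : EuclideanSpace ℝ (Fin n) → Fin m → ℝ) (c : Fin m → ℝ)
    (g : EuclideanSpace ℝ (Fin n) → ℝ)
    (hfc : ContinuousOn (fun p : ℝ × EuclideanSpace ℝ (Fin n) => f p.1 p.2) (Icc 0 T ×ˢ X))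
    (hhc : ContinuousOn h X₀) (hgc : ContinuousOn g X)
    (hX₀K : IsCompact X₀) (hXK : IsCompact X) :
    pStar hf T X₀ h c g = dStar f T X₀ X h c g := by
  have hFc : ContinuousOn (fun x => g (flow hf T x)) X₀ :=
    continuousOn_comp_flow hf hT hX hfc hXK hgc
  have hmeas : MeasurableSet X₀ := hX₀K.isClosed.measurableSet
  apply le_antisymm
  · refine sSup_le ?_
    rintro _ ⟨μ₀, hμ, rfl⟩
    refine le_sInf ?_
    rintro _ ⟨α, β, v, hv, rfl⟩
    have := hμ.1
    refine EReal.coe_le_coe_iff.2 (setIntegral_le_of_isAdmissible hμ hmeas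
      (hFc.integrableOn_compact hX₀K) hv.beta_nonneg fun x hx => ?_)
    calc g (flow hf T x) ≤ v (T, flow hf T x) := hv.le_final _ (hX x hx T ⟨hT.le, le_rfl⟩)
      _ ≤ v (0, x) :=
        apply_flow_le_of_lieDerivative_nonpos hf hT (hX x hx) hv.isC1On hv.lie_nonpos
      _ ≤ α + ∑ i, β i * h x i := hv.initial_le x hx
  · refine EReal.le_of_forall_lt_iff_le.1 fun r hr => ?_
    obtain ⟨r', hr', hrr⟩ := EReal.lt_iff_exists_real_btwn.1 hr
    rw [EReal.coe_lt_coe_iff] at hrr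
    obtain ⟨a, β, hβ, hle, hval⟩ := exists_multipliers hX₀K hFc hhc (c := c) (r := r')
      fun ι _ w z hw hw1 hz hc => by
        obtain ⟨μ₀, hμ, hint⟩ := exists_isAdmissible_of_sum_le hmeas hw hw1 hz hc
        have : ((∫ x in X₀, g (flow hf T x) ∂μ₀ : ℝ) : EReal) ≤ pStar hf T X₀ h c g :=
          le_sSup ⟨μ₀, hμ, rfl⟩
        rw [hint fun x => g (flow hf T x)] at this
        exact EReal.coe_lt_coe_iff.1 (this.trans_lt hr')
    -- the gap between `r'` and `r` pays for replacing the payoff by a smooth supersolution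
    obtain ⟨v, hv, hL, hfin, hini⟩ :=
      exists_supersolution_initial_le hf hT hX hfc hXK hX₀K hgc (sub_pos.2 hrr)
    have hfeas : IsDualFeasible f T X₀ X h g (a + (r - r')) β v :=
      { beta_nonneg := hβ
        isC1On := ⟨univ, isOpen_univ, subset_univ _, hv.contDiffOn⟩
        lie_nonpos := hL
        le_final := hfin
        initial_le := fun x hx => by linarith [hini x hx, hle x hx] }
    have hd : dStar f T X₀ X h c g ≤ ((a + (r - r') + ∑ i, β i * c i : ℝ) : EReal) :=
      sInf_le ⟨_, β, v, hfeas, rfl⟩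
    exact hd.trans (EReal.coe_le_coe_iff.2 (by linarith))
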